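/- Let $K=\{-163,-67,-43,-19,-11,-7,-3,-2,-1\}$, let $d\in K$, and let $\mathcal O=\mathcal O_{\mathbb Q(\sqrt d)}\subset\mathbb C$, that is, $\mathcal O=\mathbb Z[\frac{1+\sqrt d}{2}]$ if $d\equiv 1\pmod 4$ and $\mathcal O=\mathbb Z[\sqrt d]$ otherwise. Write $x\sim y$ if $x=uy$ for some unit $u$ of $\mathcal O$, and let $|z|=\sqrt{z\overline z}$ be the usual absolute value. Let $A(d)$ be the set of all $z\in\mathcal O\setminus\{0\}$ with $0\le\arg(z)<\theta_d$, where $\arg(z)\in[0,2\pi)$ is the argument of $z$ and $\theta_{-1}=\pi/2$, $\theta_{-3}=\pi/3$, and $\theta_d=\pi$ for the other $d\in K$; this set contains exactly one element of each class of associated nonzero elements. For $m\in\mathbb Z$ and $z\in\mathcal O\setminus\{0\}$ put \[\delta_m(z)=\sum_{x\mid z,\ x\in A(d)}|x|^m,\] and for an integer $n\ge 1$ put $I_n(z)=\delta_n(z)/|z|^n$. Elements $z,w\in\mathcal O\setminus\{0\}$ are called $n$-powerful friends if $I_n(z)=I_n(w)$ and $|z|\neq|w|$, and $z\in\mathcal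 O\setminus\{0\}$ is called $n$-powerfully solitary if it has no $n$-powerful friend in $\mathcal O\setminus\{0\}$. Then, for every integer $n\ge1$, every $d\in K$, all $z_1,z_2\in\mathcal O\setminus\{0\}$ and every prime $\pi$ of $\mathcal O$: (a) $I_n(z_1)\in[1,\infty)$, and $I_n(z_1)=1$ if and only if $z_1$ is a unit of $\mathcal O$. If $n$ is even, then $I_n(z_1)\in\mathbb Q$. (b) $I_n$ is multiplicative: if $x,y\in\mathcal O\setminus\{0\}$ have no nonunit common divisor, then $I_n(xy)=I_n(x)I_n(y)$. (c) $I_n(z_1)=\delta_{-n}(z_1)$. (d) If $z_1\mid z_2$ in $\mathcal O$, then $I_n(z_1)\le I_n(z_2)$, with equality if and only if $z_1\sim z_2$. (e) If $z_1\sim\pi^k$ for a nonnegative integer $k$, then $z_1$ is $n$-powerfully solitary (for even and for odd $n$). -/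

import Mathlib

namespace QuadAbundancy

/-- The nine negative square-free integers `d` considered. -/
def K : Set ℤ := {-163, -67, -43, -19, -11, -7, -3, -2, -1}

/-- The square root of a negative integer `d` in the upper half plane. -/
noncomputable def sqrtNeg (d : ℤ) : ℂ := Complex.I * (Real.sqrt (-(d : ℝ)) : ℂ)

/-- The quadratic integer ring, as a subring of `ℂ`: `ℤ[(1 + √d) / 2]` if `d ≡ 1 mod 4`, and
`ℤ[√d]` otherwise. -/
noncomputable def quadRing (d : ℤ) : Subalgebra ℤ ℂ :=
  if d % 4 = 1 then Algebra.adjoin ℤ {(1 + sqrtNeg d) / 2} else Algebra.adjoin ℤ {sqrtNeg d}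

/-- The absolute value `|z| = √(z z̄)`, which is the usual one of complex numbers. -/
noncomputable def absVal {d : ℤ} (z : quadRing d) : ℝ := ‖(z : ℂ)‖

/-- The upper bound for the arguments of the chosen representatives of the classes of associates. -/
noncomputable def argBound (d : ℤ) : ℝ :=
  if d = -1 then Real.pi / 2 else if d = -3 then Real.pi / 3 else Real.pi

/-- The set `A(d)`, with one representative of each class of associated nonzero elements.
As the bound is at most `π`, it does not matter here that `Complex.arg` takes its values in
`(-π, π]` and not in `[0, 2π)`. -/
def A (d : ℤ) : Set (quadRing d) :=
  {z | z ≠ 0 ∧ 0 ≤ Complex.arg (z : ℂ) ∧ Complex.arg (z : ℂ) < argBound d}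

/-- `δ_n(z)`, the sum of `|x| ^ n` over the divisors `x ∈ A(d)` of `z`
(there are finitely many of them when `z ≠ 0` and `d < 0`). -/
noncomputable def delta {d : ℤ} (n : ℤ) (z : quadRing d) : ℝ :=
  ∑ᶠ x ∈ {x : quadRing d | x ∣ z ∧ x ∈ A d}, absVal x ^ n

/-- `I_n(z) = δ_n(z) / |z| ^ n`. -/
noncomputable def abundancy {d : ℤ} (n : ℕ) (z : quadRing d) : ℝ :=
  delta (n : ℤ) z / absVal z ^ n

/-- Multiplicativity of a function on the nonzero elements. `IsRelPrime x y` says that every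
common divisor of `x` and `y` is a unit. -/
def IsMultiplicative {d : ℤ} (f : quadRing d → ℝ) : Prop :=
  ∀ x y : quadRing d, x ≠ 0 → y ≠ 0 → IsRelPrime x y → f (x * y) = f x * f y

/-- Two nonzero elements are `n`-powerful friends. -/
def PowerfulFriends {d : ℤ} (n : ℕ) (z w : quadRing d) : Prop :=
  z ≠ 0 ∧ w ≠ 0 ∧ abundancy n z = abundancy n w ∧ absVal z ≠ absVal w

/-- A nonzero element is `n`-powerfully solitary if it has no `n`-powerful friend. -/
def PowerfullySolitary {d : ℤ} (n : ℕ) (z : quadRing d) : Prop :=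
  z ≠ 0 ∧ ¬ ∃ w : quadRing d, PowerfulFriends n z w

end QuadAbundancy

/-!
Since `ℚ(√d)` is imaginary, the units are the elements of absolute value one, so `|x|` is a function
on the monoid of classes of associates, and `δ_m` is the sum of `|x| ^ m` over the divisors of a
class. In a unique factorization monoid with trivial units this makes everything but (e) formal.

Unique factorization comes from the Dedekind–Hasse criterion. By Dirichlet's approximation theorem,
every `ξ ∈ ℚ(√d)` has a multiple `m ξ` with `m ≤ B` at distance less than `1` from the ring, where
`B` is about `√(|D| / 3)` for the discriminant `D`. For the `d` considered, all prime numbers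
`p ≤ B` are inert, and an inert factor of `m` can be cancelled.

For (e), suppose `I_n(w) = I_n(p ^ k)`. Clearing denominators, `|p| ^ (n k)` divides `|w| ^ n` in
the ring of algebraic integers, because it is coprime to `1 + |p| ^ n + ⋯ + |p| ^ (n k)`. Hence
the norm of `p ^ k` divides the norm of `w`, so `w` is divisible by some `p ^ i * (conj p) ^ j`
with `i + j = k`. Already this divisor has `I_n` at least `I_n(p ^ k) = I_n(w)`, so it is
associated to `w`, and `|w| = |p| ^ k`.
-/

namespace QuadAbundancy

section Divisors

variable {M : Type*} [CommMonoidWithZero M] [UniqueFactorizationMonoid M] [Subsingleton Mˣ]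

theorem finite_setOf_dvd {z : M} (hz : z ≠ 0) : {x : M | x ∣ z}.Finite :=
  have : Fintype Mˣ := Fintype.ofSubsingleton 1
  have : Fintype {x : M // x ∣ z} := UniqueFactorizationMonoid.fintypeSubtypeDvd z hz
  Set.finite_coe_iff.1 (inferInstanceAs (Finite {x : M // x ∣ z}))

open Classical in
/-- The finite set of divisors of `z` in a unique factorization monoid whose only unit is `1`, such
as the monoid of classes of associates of a ring. As for `Nat.divisors`, it is empty if `z = 0`. -/
noncomputable def divisors (z : M) : Finset M :=
  if hz : z = 0 then ∅ else (finite_setOf_dvd hz).toFinset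

theorem mem_divisors {x z : M} : x ∈ divisors z ↔ x ∣ z ∧ z ≠ 0 := by
  unfold divisors
  split_ifs with hz <;> simp [hz]

theorem coe_divisors {z : M} (hz : z ≠ 0) : (divisors z : Set M) = {x | x ∣ z} := by
  ext x
  simp [mem_divisors, hz]

theorem divisors_one [Nontrivial M] : divisors (1 : M) = {1} := by
  ext x
  simp [mem_divisors, ← isUnit_iff_dvd_one]

theorem sum_divisors_prime_pow {R : Type*} [Semiring R] (g : M →* R) {p : M} (hp : Prime p)
    (k : ℕ) : ∑ x ∈ divisors (p ^ k), g x = ∑ j ∈ Finset.range (k + 1), g p ^ j := by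
  symm
  refine Finset.sum_nbij (p ^ ·) (fun j hj => ?_) (fun i _ j _ hij => ?_) (fun x hx => ?_)
    fun j _ => (map_pow g p j).symm
  · exact mem_divisors.2
      ⟨pow_dvd_pow p (Finset.mem_range_succ_iff.1 hj), pow_ne_zero k hp.ne_zero⟩
  · exact pow_injective_of_not_isUnit hp.not_isUnit hp.ne_zero hij
  · obtain ⟨j, hj, hxj⟩ := (dvd_prime_pow hp k).1 (mem_divisors.1 hx).1
    exact ⟨j, Finset.mem_coe.2 (Finset.mem_range_succ_iff.2 hj), (associated_iff_eq.1 hxj).symm⟩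

theorem eq_of_mul_eq_mul_of_isRelPrime {x y a b a' b' : M} (h : IsRelPrime x y) (ha : a ∣ x)
    (hb : b ∣ y) (ha' : a' ∣ x) (hb' : b' ∣ y) (hab : a * b = a' * b') : a = a' :=
  dvd_antisymm'
    (((h.of_dvd_left ha').of_dvd_right hb).dvd_of_dvd_mul_right (hab ▸ dvd_mul_right a' b'))
    (((h.of_dvd_left ha).of_dvd_right hb').dvd_of_dvd_mul_right (hab ▸ dvd_mul_right a b))

theorem sum_divisors_mul {R : Type*} [CommSemiring R] (g : M →* R) {x y : M}
    (h : IsRelPrime x y) :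
    ∑ z ∈ divisors (x * y), g z = (∑ a ∈ divisors x, g a) * ∑ b ∈ divisors y, g b := by
  rw [Finset.sum_mul_sum, ← Finset.sum_product']
  symm
  refine Finset.sum_nbij (fun ab => ab.1 * ab.2) ?_ ?_ ?_ fun ab _ => (map_mul g ab.1 ab.2).symm
  · rintro ⟨a, b⟩ hab
    simp only [Finset.mem_product, mem_divisors] at hab ⊢
    exact ⟨mul_dvd_mul hab.1.1 hab.2.1, mul_ne_zero hab.1.2 hab.2.2⟩
  · rintro ⟨a, b⟩ hab ⟨a', b'⟩ hab' heq
    simp only [Finset.coe_product, Set.mem_prod, Finset.mem_coe, mem_divisors] at hab hab' heq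
    obtain ⟨⟨ha, hx⟩, hb, -⟩ := hab
    obtain rfl := eq_of_mul_eq_mul_of_isRelPrime h ha hb hab'.1.1 hab'.2.1 heq
    rw [mul_left_cancel₀ (ne_zero_of_dvd_ne_zero hx ha) heq]
  · intro z hz
    obtain ⟨hzd, hz0⟩ := mem_divisors.1 hz
    obtain ⟨a, b, ha, hb, rfl⟩ := exists_dvd_and_dvd_of_dvd_mul hzd
    refine ⟨(a, b), ?_, rfl⟩
    simp [mem_divisors, ha, hb, left_ne_zero_of_mul hz0, right_ne_zero_of_mul hz0]

theorem sum_divisors_div {F : Type*} [Semifield F] (g : M →* F) {z : M} (hg : g z ≠ 0) :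
    (∑ x ∈ divisors z, g x) / g z = ∑ x ∈ divisors z, (g x)⁻¹ := by
  have hquot : ∀ x ∈ divisors z, ∃ y, z = x * y := fun x hx => (mem_divisors.1 hx).1
  choose! quot hquot using hquot
  have hmem : ∀ x ∈ divisors z, quot x ∈ divisors z := fun x hx =>
    mem_divisors.2 ⟨Dvd.intro_left x (hquot x hx).symm, (mem_divisors.1 hx).2⟩
  have hinv : ∀ x ∈ divisors z, quot (quot x) = x := fun x hx => by
    obtain ⟨hxz, hz⟩ := mem_divisors.1 (hmem x hx)
    refine mul_left_cancel₀ (ne_zero_of_dvd_ne_zero hz hxz) ?_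
    rw [← hquot _ (hmem x hx), mul_comm, ← hquot x hx]
  rw [Finset.sum_div]
  refine Finset.sum_nbij' quot quot hmem hmem hinv hinv fun x hx => ?_
  have hgx : g z = g x * g (quot x) := by rw [← map_mul, ← hquot x hx]
  rw [hgx] at hg ⊢
  exact div_mul_cancel_left₀ (left_ne_zero_of_mul hg) _

theorem sum_divisors_lt_sum_divisors {R : Type*} [AddCommMonoid R] [PartialOrder R]
    [IsOrderedCancelAddMonoid R] {g : M → R} {z w : M} (hg : ∀ x ∈ divisors w, 0 < g x)
    (hw : w ≠ 0) (h : z ∣ w) (hne : z ≠ w) : ∑ x ∈ divisors z, g x < ∑ x ∈ divisors w, g x := by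
  have hww : w ∈ divisors w := mem_divisors.2 ⟨dvd_rfl, hw⟩
  refine Finset.sum_lt_sum_of_subset (fun x hx => ?_) hww (fun hwz => ?_) (hg w hww)
    fun x hx _ => (hg x hx).le
  · exact mem_divisors.2 ⟨(mem_divisors.1 hx).1.trans h, hw⟩
  · exact hne (dvd_antisymm' (mem_divisors.1 hwz).1 h)

end Divisors

section QuadRing

/-- The trace of the generator `gen d`. -/
def genTrace (d : ℤ) : ℤ := if d % 4 = 1 then 1 else 0

/-- The norm of the generator `gen d`. -/
def genNorm (d : ℤ) : ℤ := if d % 4 = 1 then (1 - d) / 4 else -d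

/-- The generator `(1 + √d) / 2` or `√d` of the quadratic ring, a root of
`X ^ 2 - genTrace d * X + genNorm d`. -/
noncomputable def gen (d : ℤ) : ℂ := if d % 4 = 1 then (1 + sqrtNeg d) / 2 else sqrtNeg d

/-- The absolute value of the discriminant of the quadratic ring, for `d < 0`. -/
def absDiscr (d : ℤ) : ℤ := if d % 4 = 1 then -d else -(4 * d)

/-- The norm form of the quadratic ring, which is the norm of `a + b * gen d`. -/
def normForm (d a b : ℤ) : ℤ := a ^ 2 + genTrace d * a * b + genNorm d * b ^ 2

/-- The norm `|z| ^ 2` of an element of the quadratic ring as a natural number. For `d < 0` the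
floor does not round anything off, see `cast_absNorm`. -/
noncomputable def absNorm {d : ℤ} (z : quadRing d) : ℕ := ⌊absVal z ^ 2⌋₊

variable {d : ℤ}

theorem neg_of_mem_K (hd : d ∈ K) : d < 0 := by
  simp only [K, Set.mem_insert_iff, Set.mem_singleton_iff] at hd
  omega

theorem four_mul_genNorm (d : ℤ) : 4 * genNorm d = absDiscr d + genTrace d ^ 2 := by
  unfold genNorm absDiscr genTrace
  split_ifs <;> omega

theorem four_mul_normForm (d a b : ℤ) :
    4 * normForm d a b = (2 * a + genTrace d * b) ^ 2 + absDiscr d * b ^ 2 := by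
  unfold normForm
  linear_combination b ^ 2 * four_mul_genNorm d

theorem gen_re (d : ℤ) : (gen d).re = genTrace d / 2 := by
  unfold gen genTrace sqrtNeg
  split_ifs <;> simp

theorem gen_im_pos (hd : d < 0) : 0 < (gen d).im := by
  have h : 0 < √(-(d : ℝ)) := Real.sqrt_pos.2 (by simpa using hd)
  unfold gen sqrtNeg
  split_ifs <;> simp [h]

theorem gen_im_sq (hd : d < 0) : (gen d).im ^ 2 = absDiscr d / 4 := by
  have h : √(-(d : ℝ)) ^ 2 = -d := Real.sq_sqrt (by simpa using hd.le)
  unfold gen absDiscr sqrtNeg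
  split_ifs <;> simp [div_pow, h] <;> ring

theorem conj_gen (d : ℤ) : starRingEnd ℂ (gen d) = genTrace d - gen d := by
  apply Complex.ext
  · rw [Complex.conj_re, Complex.sub_re, Complex.intCast_re, gen_re, sub_half]
  · simp

theorem normSq_add_mul_gen (hd : d < 0) (a b : ℤ) :
    Complex.normSq (a + b * gen d) = normForm d a b := by
  have h4 : (4 * normForm d a b : ℝ) = (2 * a + genTrace d * b) ^ 2 + absDiscr d * b ^ 2 := by
    exact_mod_cast four_mul_normForm d a b
  rw [Complex.normSq_apply]
  simp only [Complex.add_re, Complex.intCast_re, Complex.mul_re, gen_re, Complex.intCast_im,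
    zero_mul, sub_zero, Complex.add_im, Complex.mul_im, add_zero, zero_add]
  linear_combination (b : ℝ) ^ 2 * gen_im_sq hd - h4 / 4

theorem gen_sq (hd : d < 0) : gen d ^ 2 = genTrace d * gen d - genNorm d := by
  have hnorm : gen d * starRingEnd ℂ (gen d) = genNorm d := by
    rw [Complex.mul_conj]
    simpa [normForm] using congrArg Complex.ofReal (normSq_add_mul_gen hd 0 1)
  rw [conj_gen] at hnorm
  linear_combination -hnorm

theorem quadRing_eq_adjoin (d : ℤ) : quadRing d = Algebra.adjoin ℤ {gen d} := by
  unfold quadRing gen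
  split_ifs <;> rfl

theorem gen_mem (d : ℤ) : gen d ∈ quadRing d := by
  rw [quadRing_eq_adjoin]
  exact Algebra.self_mem_adjoin_singleton ℤ _

theorem mem_quadRing_iff (hd : d < 0) {z : ℂ} :
    z ∈ quadRing d ↔ ∃ a b : ℤ, z = a + b * gen d := by
  constructor
  · rw [quadRing_eq_adjoin]
    intro hz
    induction hz using Algebra.adjoin_induction with
    | mem x hx => exact ⟨0, 1, by simpa using hx⟩
    | algebraMap r => exact ⟨r, 0, by simp⟩
    | add x y _ _ hx hy =>
      obtain ⟨a, b, rfl⟩ := hx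
      obtain ⟨a', b', rfl⟩ := hy
      exact ⟨a + a', b + b', by push_cast; ring⟩
    | mul x y _ _ hx hy =>
      obtain ⟨a, b, rfl⟩ := hx
      obtain ⟨a', b', rfl⟩ := hy
      refine ⟨a * a' - genNorm d * b * b', a * b' + a' * b + genTrace d * b * b', ?_⟩
      push_cast
      linear_combination (b * b' : ℂ) * gen_sq hd
  · rintro ⟨a, b, rfl⟩
    exact add_mem (intCast_mem _ a) (mul_mem (intCast_mem _ b) (gen_mem d))

theorem conj_mem {z : ℂ} (hz : z ∈ quadRing d) : starRingEnd ℂ z ∈ quadRing d := by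
  have hle : quadRing d ≤ (quadRing d).comap (starRingEnd ℂ).toIntAlgHom := by
    conv_lhs => rw [quadRing_eq_adjoin]
    refine Algebra.adjoin_le (Set.singleton_subset_iff.2 ?_)
    change starRingEnd ℂ (gen d) ∈ quadRing d
    rw [conj_gen]
    exact sub_mem (intCast_mem _ _) (gen_mem d)
  exact hle hz

/-- Complex conjugation on the quadratic ring. -/
noncomputable def conj : quadRing d ≃+* quadRing d where
  toFun z := ⟨starRingEnd ℂ z, conj_mem z.2⟩
  invFun z := ⟨starRingEnd ℂ z, conj_mem z.2⟩
  left_inv z := by ext; simp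
  right_inv z := by ext; simp
  map_mul' x y := by ext; simp
  map_add' x y := by ext; simp

@[simp]
theorem coe_conj (z : quadRing d) : (conj z : ℂ) = starRingEnd ℂ (z : ℂ) := rfl

@[simp]
theorem conj_conj (z : quadRing d) : conj (conj z) = z := conj.left_inv z

theorem absVal_one : absVal (1 : quadRing d) = 1 := by simp [absVal]

theorem absVal_mul (x y : quadRing d) : absVal (x * y) = absVal x * absVal y := by simp [absVal]

theorem absVal_pow (x : quadRing d) (k : ℕ) : absVal (x ^ k) = absVal x ^ k := by simp [absVal]

theorem absVal_natCast (m : ℕ) : absVal (m : quadRing d) = m := by simp [absVal]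

theorem absVal_conj (x : quadRing d) : absVal (conj x) = absVal x := by simp [absVal]

theorem absVal_nonneg (x : quadRing d) : 0 ≤ absVal x := norm_nonneg _

theorem absVal_pos {x : quadRing d} (hx : x ≠ 0) : 0 < absVal x :=
  norm_pos_iff.2 (by simpa using hx)

theorem absVal_sq_eq_normForm (hd : d < 0) {z : quadRing d} {a b : ℤ}
    (hz : (z : ℂ) = a + b * gen d) : absVal z ^ 2 = normForm d a b := by
  rw [absVal, ← Complex.normSq_eq_norm_sq, hz, normSq_add_mul_gen hd]

theorem cast_absNorm (hd : d < 0) (z : quadRing d) : (absNorm z : ℝ) = absVal z ^ 2 := by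
  obtain ⟨a, b, hz⟩ := (mem_quadRing_iff hd).1 z.2
  have hsq := absVal_sq_eq_normForm hd hz
  obtain ⟨N, hN⟩ : ∃ N : ℕ, normForm d a b = N :=
    Int.eq_ofNat_of_zero_le (by exact_mod_cast hsq ▸ sq_nonneg (absVal z))
  rw [absNorm, hsq, hN, Int.cast_natCast, Nat.floor_natCast]

theorem absNorm_eq_normForm (hd : d < 0) {z : quadRing d} {a b : ℤ}
    (hz : (z : ℂ) = a + b * gen d) : (absNorm z : ℤ) = normForm d a b := by
  exact_mod_cast (cast_absNorm hd z).trans (absVal_sq_eq_normForm hd hz)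

theorem absNorm_mul (hd : d < 0) (x y : quadRing d) :
    absNorm (x * y) = absNorm x * absNorm y := by
  have h : (absNorm (x * y) : ℝ) = absNorm x * absNorm y := by
    simp only [cast_absNorm hd, absVal_mul, mul_pow]
  exact_mod_cast h

theorem absNorm_natCast (m : ℕ) : absNorm (m : quadRing d) = m ^ 2 := by
  rw [absNorm, absVal_natCast, ← Nat.cast_pow, Nat.floor_natCast]

theorem absNorm_lt_iff (hd : d < 0) {x y : quadRing d} :
    absNorm x < absNorm y ↔ absVal x < absVal y := by
  rw [← Nat.cast_lt (α := ℝ), cast_absNorm hd, cast_absNorm hd,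
    sq_lt_sq₀ (absVal_nonneg x) (absVal_nonneg y)]

theorem mul_conj (hd : d < 0) (z : quadRing d) : z * conj z = absNorm z := by
  ext
  have h : ((absNorm z : ℝ) : ℂ) = (absVal z ^ 2 : ℝ) := congrArg _ (cast_absNorm hd z)
  push_cast at h
  simp [Complex.mul_conj, Complex.normSq_eq_norm_sq, h, absVal]

theorem isUnit_iff_absVal_eq_one (hd : d < 0) {z : quadRing d} : IsUnit z ↔ absVal z = 1 := by
  constructor
  · intro hz
    obtain ⟨y, hy⟩ := hz.exists_right_inv
    have hone : absNorm z * absNorm y = 1 := by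
      rw [← absNorm_mul hd, hy, ← Nat.cast_one, absNorm_natCast, one_pow]
    have hsq := cast_absNorm hd z
    rw [Nat.eq_one_of_mul_eq_one_right hone, Nat.cast_one] at hsq
    exact (pow_eq_one_iff_of_nonneg (absVal_nonneg z) two_ne_zero).1 hsq.symm
  · intro hz
    have hone : (absNorm z : ℝ) = 1 := by rw [cast_absNorm hd, hz, one_pow]
    exact IsUnit.of_mul_eq_one (conj z) (by rw [mul_conj hd]; exact_mod_cast hone)

theorem absVal_eq_of_associated (hd : d < 0) {x y : quadRing d} (h : Associated x y) :
    absVal x = absVal y := by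
  obtain ⟨u, rfl⟩ := h
  rw [absVal_mul, (isUnit_iff_absVal_eq_one hd).1 u.isUnit, mul_one]

end QuadRing

section Principal

theorem isPrincipalIdealRing_of_dedekindHasse {R : Type*} [CommRing R] (N : R → ℕ)
    (h : ∀ a b : R, b ≠ 0 → ¬ b ∣ a → ∃ e ∈ Ideal.span {a, b}, e ≠ 0 ∧ N e < N b) :
    IsPrincipalIdealRing R := by
  refine ⟨fun I => ?_⟩
  obtain rfl | hI := eq_or_ne I ⊥
  · infer_instance
  obtain ⟨x, hxI, hx0⟩ := Submodule.exists_mem_ne_zero_of_ne_bot hI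
  obtain ⟨b, ⟨hbI, hb0⟩, hmin⟩ := (measure N).wf.has_min {x | x ∈ I ∧ x ≠ 0} ⟨x, hxI, hx0⟩
  refine ⟨b, le_antisymm (fun a ha => Ideal.mem_span_singleton.2 ?_)
    ((Ideal.span_singleton_le_iff_mem I).2 hbI)⟩
  by_contra hba
  obtain ⟨e, he, he0, hlt⟩ := h a b hb0 hba
  exact hmin e ⟨Ideal.span_le.2 (Set.pair_subset ha hbI) he, he0⟩ hlt

/-- The norm form has no nontrivial zero modulo `p`. For a prime number `p` this means that `p` is
inert in the quadratic ring. The zeros range over `ℕ` to make this decidable. -/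
def AnisotropicMod (d : ℤ) (p : ℕ) : Prop :=
  ∀ a < p, ∀ b < p, (p : ℤ) ∣ normForm d a b → a = 0 ∧ b = 0

instance (d : ℤ) : DecidablePred (AnisotropicMod d) := fun p =>
  inferInstanceAs (Decidable (∀ a < p, ∀ b < p, (p : ℤ) ∣ normForm d a b → a = 0 ∧ b = 0))

variable {d : ℤ}

theorem AnisotropicMod.dvd_and_dvd {p : ℕ} (h : AnisotropicMod d p) (hp : p ≠ 0) {a b : ℤ}
    (hab : (p : ℤ) ∣ normForm d a b) : (p : ℤ) ∣ a ∧ (p : ℤ) ∣ b := by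
  have hp0 : (0 : ℤ) < p := by positivity
  obtain ⟨r, hr⟩ := Int.eq_ofNat_of_zero_le (Int.emod_nonneg a hp0.ne')
  obtain ⟨s, hs⟩ := Int.eq_ofNat_of_zero_le (Int.emod_nonneg b hp0.ne')
  have hra : r ≡ a [ZMOD p] := hr ▸ Int.mod_modEq a p
  have hsb : s ≡ b [ZMOD p] := hs ▸ Int.mod_modEq b p
  have hform : normForm d r s ≡ normForm d a b [ZMOD p] := by
    unfold normForm
    gcongr
  have hrs := h r (by have := Int.emod_lt_of_pos a hp0; omega) s
    (by have := Int.emod_lt_of_pos b hp0; omega) (hform.dvd_iff.2 hab)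
  rw [Int.dvd_iff_emod_eq_zero, Int.dvd_iff_emod_eq_zero, hr, hs]
  exact_mod_cast hrs

theorem AnisotropicMod.natCast_dvd {p : ℕ} (h : AnisotropicMod d p) (hd : d < 0) (hp : p ≠ 0)
    {z : quadRing d} (hz : p ∣ absNorm z) : (p : quadRing d) ∣ z := by
  obtain ⟨a, b, hab⟩ := (mem_quadRing_iff hd).1 z.2
  rw [← Int.natCast_dvd_natCast, absNorm_eq_normForm hd hab] at hz
  obtain ⟨⟨a', rfl⟩, ⟨b', rfl⟩⟩ := h.dvd_and_dvd hp hz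
  refine ⟨⟨a' + b' * gen d, (mem_quadRing_iff hd).2 ⟨a', b', rfl⟩⟩, Subtype.ext ?_⟩
  rw [hab]
  push_cast
  ring

theorem AnisotropicMod.prime_natCast {p : ℕ} (h : AnisotropicMod d p) (hd : d < 0)
    (hp : p.Prime) : Prime (p : quadRing d) := by
  refine ⟨by exact_mod_cast hp.ne_zero, fun hu => ?_, fun x y hxy => ?_⟩
  · rw [isUnit_iff_absVal_eq_one hd, absVal_natCast] at hu
    exact hp.one_lt.ne' (by exact_mod_cast hu)
  · have hN : p ∣ absNorm x * absNorm y := by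
      obtain ⟨w, hw⟩ := hxy
      rw [← absNorm_mul hd, hw, absNorm_mul hd, absNorm_natCast]
      exact Dvd.dvd.mul_right (dvd_pow_self p two_ne_zero) _
    exact (hp.dvd_mul.1 hN).imp (h.natCast_dvd hd hp.ne_zero) (h.natCast_dvd hd hp.ne_zero)

theorem natCast_dvd_of_dvd_absNorm (hd : d < 0) {p : ℕ} (hp : Prime (p : quadRing d))
    {z : quadRing d} (hz : p ∣ absNorm z) : (p : quadRing d) ∣ z := by
  have hzz : (p : quadRing d) ∣ z * conj z := by
    rw [mul_conj hd]
    exact_mod_cast Nat.cast_dvd_cast hz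
  refine (hp.dvd_or_dvd hzz).elim id fun hc => ?_
  simpa using map_dvd conj hc

theorem exists_mem_span_pair_mul_eq (hd : d < 0) {p : ℕ} (hp : p.Prime)
    (hpR : Prime (p : quadRing d)) {a b : quadRing d} (h : b ∣ p * a) (hba : ¬ b ∣ a) :
    ∃ e ∈ Ideal.span {a, b}, p * e = b := by
  obtain ⟨β, hβ⟩ := h
  have hpβ : ¬ p ∣ absNorm β := by
    intro hdvd
    obtain ⟨γ, rfl⟩ := natCast_dvd_of_dvd_absNorm hd hpR hdvd
    exact hba ⟨γ, mul_left_cancel₀ hpR.ne_zero (by rw [hβ, mul_left_comm])⟩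
  obtain ⟨s, r, hsr⟩ : IsCoprime (p : quadRing d) (absNorm β) := by
    exact_mod_cast (Nat.isCoprime_iff_coprime.2 ((hp.coprime_iff_not_dvd).2 hpβ)).map
      (Int.castRingHom (quadRing d))
  refine ⟨r * conj β * a + s * b, Ideal.mem_span_pair.2 ⟨_, _, rfl⟩, ?_⟩
  linear_combination b * hsr + r * conj β * hβ + r * b * mul_conj hd β

theorem exists_mem_span_pair_absNorm_lt (hd : d < 0) {b : quadRing d} (hb : b ≠ 0) (m : ℕ)
    (hm : m ≠ 0) (hprime : ∀ p : ℕ, p.Prime → p ∣ m → Prime (p : quadRing d)) {a : quadRing d}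
    (h : b ∣ m * a) (hba : ¬ b ∣ a) :
    ∃ e ∈ Ideal.span {a, b}, e ≠ 0 ∧ absNorm e < absNorm b := by
  induction m using induction_on_primes generalizing a with
  | zero => exact absurd rfl hm
  | one => exact absurd (by simpa using h) hba
  | prime_mul p m hp ih =>
    have hprime' : ∀ q : ℕ, q.Prime → q ∣ m → Prime (q : quadRing d) :=
      fun q hq hqm => hprime q hq (hqm.mul_left p)
    by_cases hbpa : b ∣ p * a
    · obtain ⟨e, he, rfl⟩ :=
        exists_mem_span_pair_mul_eq hd hp (hprime p hp (dvd_mul_right p m)) hbpa hba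
      have he0 : e ≠ 0 := right_ne_zero_of_mul hb
      have hpos : 0 < absNorm e := by
        have := cast_absNorm hd e ▸ pow_pos (absVal_pos he0) 2
        exact_mod_cast this
      refine ⟨e, he, he0, ?_⟩
      rw [absNorm_mul hd, absNorm_natCast]
      exact lt_mul_of_one_lt_left hpos (Nat.one_lt_pow two_ne_zero hp.one_lt)
    · obtain ⟨e, he, hlt⟩ := ih (right_ne_zero_of_mul hm) hprime' (a := p * a)
        (by rw [← mul_assoc]; convert h using 2; push_cast; ring) hbpa
      refine ⟨e, Ideal.span_le.2 (Set.pair_subset ?_ ?_) he, hlt⟩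
      · exact Ideal.mul_mem_left _ _ (Ideal.subset_span (Set.mem_insert a {b}))
      · exact Ideal.subset_span (Set.mem_insert_of_mem a rfl)

theorem exists_natCast_mul_sub_norm_lt_one (hd : d < 0) {B : ℕ} (hB0 : 0 < B)
    (hB : absDiscr d < 3 * ((B : ℤ) + 1) ^ 2) (ξ : ℂ) :
    ∃ m : ℕ, 0 < m ∧ m ≤ B ∧ ∃ γ : quadRing d, ‖m * ξ - γ‖ < 1 := by
  obtain ⟨m, hm, hmB, him⟩ := Real.exists_nat_abs_mul_sub_round_le (ξ.im / (gen d).im) hB0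
  set b := round (m * (ξ.im / (gen d).im))
  have hre := abs_sub_round (m * ξ.re - b * (gen d).re)
  set a := round (m * ξ.re - b * (gen d).re)
  refine ⟨m, hm, hmB, ⟨a + b * gen d, (mem_quadRing_iff hd).2 ⟨a, b, rfl⟩⟩, ?_⟩
  have hgen : (gen d).im ^ 2 < 3 / 4 * ((B : ℝ) + 1) ^ 2 := by
    have : (absDiscr d : ℝ) < 3 * ((B : ℝ) + 1) ^ 2 := by exact_mod_cast hB
    linarith [gen_im_sq hd]
  have hre_sq : (m * ξ - (a + b * gen d)).re ^ 2 ≤ 1 / 4 := by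
    have : (m * ξ - (a + b * gen d)).re = m * ξ.re - b * (gen d).re - a := by
      simp [sub_sub, add_comm]
    rw [this, ← sq_abs]
    exact (pow_le_pow_left₀ (abs_nonneg _) hre 2).trans_eq (by norm_num)
  have him_sq : (m * ξ - (a + b * gen d)).im ^ 2 < 3 / 4 := by
    have hfac : (m * ξ - (a + b * gen d)).im = (m * (ξ.im / (gen d).im) - b) * (gen d).im := by
      rw [sub_mul, mul_assoc, div_mul_cancel₀ _ (gen_im_pos hd).ne']
      simp
    calc (m * ξ - (a + b * gen d)).im ^ 2
        = |m * (ξ.im / (gen d).im) - b| ^ 2 * (gen d).im ^ 2 := by rw [hfac, mul_pow, sq_abs]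
      _ ≤ (1 / ((B : ℝ) + 1)) ^ 2 * (gen d).im ^ 2 := by gcongr
      _ < (1 / ((B : ℝ) + 1)) ^ 2 * (3 / 4 * ((B : ℝ) + 1) ^ 2) := by gcongr
      _ = 3 / 4 := by field_simp
  rw [← sq_lt_one_iff₀ (norm_nonneg _), ← Complex.normSq_eq_norm_sq, Complex.normSq_apply]
  linarith

theorem isPrincipalIdealRing_of_prime_natCast (hd : d < 0) {B : ℕ} (hB0 : 0 < B)
    (hB : absDiscr d < 3 * ((B : ℤ) + 1) ^ 2)
    (hprime : ∀ p ≤ B, p.Prime → Prime (p : quadRing d)) :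
    IsPrincipalIdealRing (quadRing d) := by
  refine isPrincipalIdealRing_of_dedekindHasse absNorm fun a b hb hba => ?_
  have hbC : (b : ℂ) ≠ 0 := by simpa using hb
  obtain ⟨m, hm, hmB, γ, hγ⟩ := exists_natCast_mul_sub_norm_lt_one hd hB0 hB (a / b)
  by_cases hr : m * a - γ * b = 0
  · refine exists_mem_span_pair_absNorm_lt hd hb m hm.ne'
      (fun p hp hpm => hprime p ((Nat.le_of_dvd hm hpm).trans hmB) hp) ?_ hba
    exact sub_eq_zero.1 hr ▸ dvd_mul_left b γ
  · refine ⟨m * a - γ * b, ?_, hr, (absNorm_lt_iff hd).2 ?_⟩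
    · exact Ideal.mem_span_pair.2 ⟨m, -γ, by ring⟩
    · have hfac : ((m * a - γ * b : quadRing d) : ℂ) = (m * (a / b) - γ) * b := by
        push_cast
        field_simp
      rw [absVal, hfac, norm_mul]
      exact mul_lt_of_lt_one_left (norm_pos_iff.2 hbC) hγ

theorem isPrincipalIdealRing (hd : d ∈ K) : IsPrincipalIdealRing (quadRing d) := by
  have key : ∀ B : ℕ, 0 < B → absDiscr d < 3 * ((B : ℤ) + 1) ^ 2 →
      (∀ p ≤ B, p.Prime → AnisotropicMod d p) →
      IsPrincipalIdealRing (quadRing d) := fun B hB0 hB h =>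
    have hd0 := neg_of_mem_K hd
    isPrincipalIdealRing_of_prime_natCast hd0 hB0 hB
      fun p hpB hp => (h p hpB hp).prime_natCast hd0 hp
  simp only [K, Set.mem_insert_iff, Set.mem_singleton_iff] at hd
  -- `B` is minimal with `absDiscr d < 3 * (B + 1) ^ 2`.
  rcases hd with rfl | rfl | rfl | rfl | rfl | rfl | rfl | rfl | rfl
  · exact key 7 (by decide) (by decide) (by decide +kernel)
  · exact key 4 (by decide) (by decide) (by decide +kernel)
  · exact key 3 (by decide) (by decide) (by decide +kernel)
  · exact key 2 (by decide) (by decide) (by decide +kernel)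
  all_goals exact key 1 (by decide) (by decide) (by decide +kernel)

end Principal

section Representatives

variable {d : ℤ}

theorem argBound_pos (d : ℤ) : 0 < argBound d := by
  unfold argBound
  split_ifs <;> linarith [Real.pi_pos]

theorem argBound_le_pi (d : ℤ) : argBound d ≤ Real.pi := by
  unfold argBound
  split_ifs <;> linarith [Real.pi_pos]

theorem exp_argBound_mem (d : ℤ) : Complex.exp (argBound d * Complex.I) ∈ quadRing d := by
  unfold argBound
  split_ifs with h1 h3
  · subst h1
    convert gen_mem (-1) using 1
    push_cast
    rw [Complex.exp_pi_div_two_mul_I]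
    simp [gen, sqrtNeg]
  · subst h3
    convert gen_mem (-3) using 1
    rw [Complex.exp_mul_I, ← Complex.ofReal_cos, ← Complex.ofReal_sin, Real.cos_pi_div_three,
      Real.sin_pi_div_three]
    have hsqrt : √(-((-3 : ℤ) : ℝ)) = √3 := by norm_num
    rw [gen, if_pos (by decide), sqrtNeg, hsqrt]
    push_cast
    ring
  · rw [Complex.exp_pi_mul_I]
    exact neg_mem (one_mem _)

theorem arg_eq_of_coe_angle_eq {z : ℂ} {φ : ℝ} (hφ : φ ∈ Set.Ioc (-Real.pi) Real.pi)
    (h : (Complex.arg z : Real.Angle) = φ) : Complex.arg z = φ := by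
  rw [← Real.Angle.toReal_coe_eq_self_iff_mem_Ioc.2 hφ, ← h, Complex.arg_coe_angle_toReal_eq_arg]

theorem coe_units_zpow (u : (quadRing d)ˣ) (k : ℤ) :
    (((u ^ k : (quadRing d)ˣ) : quadRing d) : ℂ) = ((u : quadRing d) : ℂ) ^ k := by
  have h := congrArg Units.val (map_zpow (Units.map ((quadRing d).val : quadRing d →* ℂ)) u k)
  rwa [Units.val_zpow_eq_zpow_val] at h

theorem exists_mem_A_associated (hd : d < 0) {z : quadRing d} (hz : z ≠ 0) :
    ∃ x ∈ A d, Associated x z := by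
  obtain ⟨u, hu⟩ : IsUnit (⟨_, exp_argBound_mem d⟩ : quadRing d) :=
    (isUnit_iff_absVal_eq_one hd).2 (Complex.norm_exp_ofReal_mul_I _)
  have huC : ((u : quadRing d) : ℂ) = Complex.exp (argBound d * Complex.I) := congrArg _ hu
  have hargu : (Complex.arg (u : quadRing d) : Real.Angle) = argBound d := by
    rw [huC, Complex.exp_mul_I, Complex.arg_cos_add_sin_mul_I
      ⟨by linarith [argBound_pos d, Real.pi_pos], argBound_le_pi d⟩]
  obtain ⟨k, hk0, hk1⟩ : ∃ k : ℤ, 0 ≤ Complex.arg z - k • argBound d ∧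
      Complex.arg z - k • argBound d < argBound d := by
    refine ⟨toIcoDiv (argBound_pos d) 0 (Complex.arg z), ?_⟩
    simpa only [zero_add, Set.mem_Ico] using
      sub_toIcoDiv_zsmul_mem_Ico (argBound_pos d) 0 (Complex.arg z)
  have harg : Complex.arg ((z * ↑(u ^ (-k)) : quadRing d) : ℂ)
      = Complex.arg z - k • argBound d := by
    refine arg_eq_of_coe_angle_eq ⟨?_, ?_⟩ ?_
    · linarith [Real.pi_pos]
    · linarith [argBound_le_pi d]
    · rw [MulMemClass.coe_mul, Complex.arg_mul_coe_angle (by simpa using hz) (by simp),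
        coe_units_zpow, Complex.arg_zpow_coe_angle, hargu, neg_smul, ← sub_eq_add_neg]
      rfl
  refine ⟨z * ↑(u ^ (-k)), ⟨mul_ne_zero hz (Units.ne_zero _), ?_, ?_⟩,
    (associated_mul_unit_right z _ (Units.isUnit _)).symm⟩
  · rwa [harg]
  · rwa [harg]

theorem re_le_cos_argBound_of_normForm_eq_one (hd : d < 0) {a b : ℤ} (hb : 0 < b)
    (h : normForm d a b = 1) : (a + b * (genTrace d / 2) : ℝ) ≤ Real.cos (argBound d) := by
  have h4 := four_mul_normForm d a b
  rw [h, mul_one] at h4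
  have hdiscr : absDiscr d ≤ 4 := by nlinarith [sq_nonneg (2 * a + genTrace d * b)]
  obtain rfl | rfl : d = -1 ∨ d = -3 := by
    unfold absDiscr at hdiscr
    split_ifs at hdiscr <;> omega
  · have ha : a = 0 := by
      have : (2 * a) ^ 2 + 4 * b ^ 2 = 4 := by simpa [genTrace, absDiscr] using h4.symm
      nlinarith
    simp [ha, argBound, genTrace]
  · have hab : 2 * a + b ≤ 1 := by
      have : (2 * a + b) ^ 2 + 3 * b ^ 2 = 4 := by simpa [genTrace, absDiscr] using h4.symm
      nlinarith
    have hcos : Real.cos (argBound (-3)) = 1 / 2 := by simp [argBound]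
    have htrace : genTrace (-3) = 1 := rfl
    rw [hcos, htrace]
    have : (2 * a + b : ℝ) ≤ 1 := by exact_mod_cast hab
    push_cast
    linarith

theorem eq_one_of_isUnit_of_mem_A (hd : d < 0) {u : quadRing d} (hu : IsUnit u) (hA : u ∈ A d) :
    u = 1 := by
  obtain ⟨hu0, harg0, harg⟩ := hA
  have hnorm : absVal u = 1 := (isUnit_iff_absVal_eq_one hd).1 hu
  have hre : Real.cos (argBound d) < (u : ℂ).re := by
    have hcos := Complex.cos_arg (x := u) (by simpa using hu0)
    rw [← absVal, hnorm, div_one] at hcos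
    exact hcos ▸ Real.cos_lt_cos_of_nonneg_of_le_pi harg0 (argBound_le_pi d) harg
  obtain ⟨a, b, hab⟩ := (mem_quadRing_iff hd).1 u.2
  have hform : normForm d a b = 1 := by
    have hsq := absVal_sq_eq_normForm hd hab
    rw [hnorm, one_pow] at hsq
    exact_mod_cast hsq.symm
  have hb : 0 ≤ b := by
    have him : 0 ≤ (b : ℝ) * (gen d).im := by
      simpa [hab] using Complex.arg_nonneg_iff.1 harg0
    exact_mod_cast nonneg_of_mul_nonneg_left him (gen_im_pos hd)
  obtain rfl | hb := hb.eq_or_lt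
  · obtain rfl | rfl : a = 1 ∨ a = -1 := by simpa [normForm] using hform
    · exact Subtype.ext (by simpa using hab)
    · have hneg : (u : ℂ).re = -1 := by simp [hab]
      exact absurd (Real.neg_one_le_cos (argBound d)) (hneg ▸ hre).not_ge
  · have hure : (u : ℂ).re = a + b * (genTrace d / 2) := by simp [hab, gen_re]
    exact absurd (re_le_cos_argBound_of_normForm_eq_one hd hb hform) (hure ▸ hre).not_ge

theorem eq_of_mem_A_of_associated (hd : d < 0) {x y : quadRing d} (hx : x ∈ A d) (hy : y ∈ A d)
    (h : Associated x y) : x = y := by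
  wlog hle : Complex.arg x ≤ Complex.arg y generalizing x y
  · exact (this hy hx h.symm (le_of_not_ge hle)).symm
  obtain ⟨hx0, hargx, -⟩ := hx
  obtain ⟨-, -, hargy⟩ := hy
  obtain ⟨u, rfl⟩ := h
  have harg : Complex.arg (u : quadRing d) =
      Complex.arg ((x * u : quadRing d) : ℂ) - Complex.arg x := by
    refine arg_eq_of_coe_angle_eq ⟨?_, ?_⟩ ?_
    · linarith [Real.pi_pos]
    · linarith [argBound_le_pi d]
    · rw [Real.Angle.coe_sub, MulMemClass.coe_mul,
        Complex.arg_mul_coe_angle (by simpa using hx0) (by simp), add_sub_cancel_left]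
  rw [eq_one_of_isUnit_of_mem_A hd u.isUnit ⟨u.ne_zero, by linarith, by linarith⟩, mul_one]

/-- The function `|x| ^ m` on the classes of associates. -/
noncomputable def absZPow (hd : d < 0) (m : ℤ) : Associates (quadRing d) →* ℝ where
  toFun := Quotient.lift (fun x => absVal x ^ m) fun x y h => by
    simp only [absVal_eq_of_associated hd h]
  map_one' := by
    change absVal 1 ^ m = 1
    rw [absVal_one, one_zpow]
  map_mul' x y := by
    induction x, y using Quotient.inductionOn₂ with | _ x y
    change absVal (x * y) ^ m = absVal x ^ m * absVal y ^ m
    rw [absVal_mul, mul_zpow]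

theorem absZPow_mk (hd : d < 0) (m : ℤ) (x : quadRing d) :
    absZPow hd m (Associates.mk x) = absVal x ^ m := rfl

theorem absZPow_pos (hd : d < 0) (m : ℤ) {x : Associates (quadRing d)} (hx : x ≠ 0) :
    0 < absZPow hd m x := by
  obtain ⟨x, rfl⟩ := Associates.mk_surjective x
  exact zpow_pos (absVal_pos (Associates.mk_ne_zero.1 hx)) m

theorem delta_eq_sum_divisors [UniqueFactorizationMonoid (quadRing d)] (hd : d < 0) (m : ℤ)
    {z : quadRing d} (hz : z ≠ 0) :
    delta m z = ∑ x ∈ divisors (Associates.mk z), absZPow hd m x := by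
  have hbij : Set.BijOn Associates.mk {x : quadRing d | x ∣ z ∧ x ∈ A d}
      {x | x ∣ Associates.mk z} := by
    refine ⟨fun x hx => Associates.mk_dvd_mk.2 hx.1, fun x hx y hy h => ?_, fun c hc => ?_⟩
    · exact eq_of_mem_A_of_associated hd hx.2 hy.2 (Associates.mk_eq_mk_iff_associated.1 h)
    · obtain ⟨c, rfl⟩ := Associates.mk_surjective c
      have hcz : c ∣ z := Associates.mk_dvd_mk.1 hc
      obtain ⟨x, hx, hxc⟩ := exists_mem_A_associated hd (ne_zero_of_dvd_ne_zero hz hcz)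
      exact ⟨x, ⟨hxc.dvd.trans hcz, hx⟩, Associates.mk_eq_mk_iff_associated.2 hxc⟩
  rw [delta, finsum_mem_eq_of_bijOn _ hbij fun x _ => (absZPow_mk hd m x).symm,
    ← coe_divisors (Associates.mk_ne_zero.2 hz), finsum_mem_coe_finset]

end Representatives

section Delta

variable {d : ℤ} [UniqueFactorizationMonoid (quadRing d)]

theorem delta_one (hd : d < 0) (m : ℤ) : delta m (1 : quadRing d) = 1 := by
  rw [delta_eq_sum_divisors hd m one_ne_zero, Associates.mk_one, divisors_one,
    Finset.sum_singleton, map_one]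

theorem delta_mul (hd : d < 0) (m : ℤ) {x y : quadRing d} (hx : x ≠ 0) (hy : y ≠ 0)
    (h : IsRelPrime x y) : delta m (x * y) = delta m x * delta m y := by
  rw [delta_eq_sum_divisors hd m hx, delta_eq_sum_divisors hd m hy,
    delta_eq_sum_divisors hd m (mul_ne_zero hx hy), ← Associates.mk_mul_mk,
    sum_divisors_mul _ (Associates.mk_isRelPrime_iff.2 h)]

theorem delta_prime_pow (hd : d < 0) (m : ℤ) {p : quadRing d} (hp : Prime p) (k : ℕ) :
    delta m (p ^ k) = ∑ j ∈ Finset.range (k + 1), (absVal p ^ m) ^ j := by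
  rw [delta_eq_sum_divisors hd m (pow_ne_zero k hp.ne_zero), Associates.mk_pow,
    sum_divisors_prime_pow _ (Associates.prime_mk.2 hp), absZPow_mk]

theorem delta_div_zpow (hd : d < 0) (m : ℤ) {z : quadRing d} (hz : z ≠ 0) :
    delta m z / absVal z ^ m = delta (-m) z := by
  rw [delta_eq_sum_divisors hd m hz, delta_eq_sum_divisors hd (-m) hz, ← absZPow_mk hd,
    sum_divisors_div _ (absZPow_pos hd m (Associates.mk_ne_zero.2 hz)).ne']
  refine Finset.sum_congr rfl fun x _ => ?_
  obtain ⟨x, rfl⟩ := Associates.mk_surjective x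
  rw [absZPow_mk, absZPow_mk, zpow_neg]

theorem delta_eq_of_associated (hd : d < 0) (m : ℤ) {z w : quadRing d} (hz : z ≠ 0)
    (h : Associated z w) : delta m z = delta m w := by
  rw [delta_eq_sum_divisors hd m hz, delta_eq_sum_divisors hd m (h.ne_zero_iff.1 hz),
    Associates.mk_eq_mk_iff_associated.2 h]

theorem delta_lt_of_dvd_of_not_associated (hd : d < 0) (m : ℤ) {z w : quadRing d} (hw : w ≠ 0)
    (h : z ∣ w) (hzw : ¬ Associated z w) : delta m z < delta m w := by
  rw [delta_eq_sum_divisors hd m (ne_zero_of_dvd_ne_zero hw h), delta_eq_sum_divisors hd m hw]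
  refine sum_divisors_lt_sum_divisors (fun x hx => ?_) (Associates.mk_ne_zero.2 hw)
    (Associates.mk_dvd_mk.2 h) (mt Associates.mk_eq_mk_iff_associated.1 hzw)
  obtain ⟨hxw, hw'⟩ := mem_divisors.1 hx
  exact absZPow_pos hd m (ne_zero_of_dvd_ne_zero hw' hxw)

theorem delta_le_of_dvd (hd : d < 0) (m : ℤ) {z w : quadRing d} (hw : w ≠ 0) (h : z ∣ w) :
    delta m z ≤ delta m w := by
  by_cases hzw : Associated z w
  · exact (delta_eq_of_associated hd m (ne_zero_of_dvd_ne_zero hw h) hzw).le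
  · exact (delta_lt_of_dvd_of_not_associated hd m hw h hzw).le

theorem delta_eq_iff_associated_of_dvd (hd : d < 0) (m : ℤ) {z w : quadRing d} (hw : w ≠ 0)
    (h : z ∣ w) : delta m z = delta m w ↔ Associated z w := by
  refine ⟨fun heq => ?_, delta_eq_of_associated hd m (ne_zero_of_dvd_ne_zero hw h)⟩
  by_contra hzw
  exact (delta_lt_of_dvd_of_not_associated hd m hw h hzw).ne heq

theorem abundancy_eq_delta_neg (hd : d < 0) (n : ℕ) {z : quadRing d} (hz : z ≠ 0) :
    abundancy n z = delta (-n) z := by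
  rw [abundancy, ← zpow_natCast, delta_div_zpow hd n hz]

theorem isMultiplicative_abundancy (hd : d < 0) (n : ℕ) :
    IsMultiplicative (abundancy n : quadRing d → ℝ) := fun x y hx hy h => by
  rw [abundancy_eq_delta_neg hd n (mul_ne_zero hx hy), abundancy_eq_delta_neg hd n hx,
    abundancy_eq_delta_neg hd n hy, delta_mul hd _ hx hy h]

theorem abundancy_le_of_dvd (hd : d < 0) (n : ℕ) {z w : quadRing d} (hw : w ≠ 0) (h : z ∣ w) :
    abundancy n z ≤ abundancy n w := by
  rw [abundancy_eq_delta_neg hd n hw,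
    abundancy_eq_delta_neg hd n (ne_zero_of_dvd_ne_zero hw h)]
  exact delta_le_of_dvd hd _ hw h

theorem abundancy_eq_iff_associated_of_dvd (hd : d < 0) (n : ℕ) {z w : quadRing d} (hw : w ≠ 0)
    (h : z ∣ w) : abundancy n z = abundancy n w ↔ Associated z w := by
  rw [abundancy_eq_delta_neg hd n hw,
    abundancy_eq_delta_neg hd n (ne_zero_of_dvd_ne_zero hw h)]
  exact delta_eq_iff_associated_of_dvd hd _ hw h

theorem abundancy_one (hd : d < 0) (n : ℕ) : abundancy n (1 : quadRing d) = 1 := by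
  rw [abundancy_eq_delta_neg hd n one_ne_zero, delta_one hd]

theorem one_le_abundancy (hd : d < 0) (n : ℕ) {z : quadRing d} (hz : z ≠ 0) :
    1 ≤ abundancy n z :=
  abundancy_one hd n ▸ abundancy_le_of_dvd hd n hz (one_dvd z)

theorem abundancy_eq_one_iff_isUnit (hd : d < 0) (n : ℕ) {z : quadRing d} (hz : z ≠ 0) :
    abundancy n z = 1 ↔ IsUnit z := by
  rw [← associated_one_iff_isUnit, ← abundancy_one hd n, eq_comm,
    abundancy_eq_iff_associated_of_dvd hd n hz (one_dvd z), Associated.comm]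

end Delta

section Rationality

variable {d : ℤ}

theorem delta_mem {S : Type*} [SetLike S ℝ] [AddSubmonoidClass S ℝ] (s : S) (m : ℤ)
    (z : quadRing d) (h : ∀ x : quadRing d, absVal x ^ m ∈ s) : delta m z ∈ s :=
  finsum_mem_induction (· ∈ s) (zero_mem s) (fun _ _ => add_mem) fun x _ => h x

theorem exists_rat_abundancy_eq (hd : d < 0) {n : ℕ} (hn : Even n) (z : quadRing d) :
    ∃ q : ℚ, abundancy n z = q := by
  have hmem (x : quadRing d) : absVal x ^ n ∈ (algebraMap ℚ ℝ).fieldRange := by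
    obtain ⟨m, rfl⟩ := hn
    rw [← two_mul, pow_mul, ← cast_absNorm hd]
    exact pow_mem (natCast_mem _ _) m
  obtain ⟨q, hq⟩ : abundancy n z ∈ (algebraMap ℚ ℝ).fieldRange :=
    div_mem (delta_mem _ n z fun x => by simpa using hmem x) (hmem z)
  exact ⟨q, hq.symm⟩

theorem isIntegral_absVal (hd : d < 0) (x : quadRing d) : IsIntegral ℤ (absVal x) := by
  refine IsIntegral.of_pow two_pos ?_
  rw [← cast_absNorm hd]
  exact isIntegral_natCast _

theorem isIntegral_delta (hd : d < 0) (n : ℕ) (z : quadRing d) : IsIntegral ℤ (delta n z) :=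
  delta_mem (integralClosure ℤ ℝ) n z fun x => by
    simpa using pow_mem (S := integralClosure ℤ ℝ) (isIntegral_absVal hd x) n

end Rationality

section Solitary

theorem dvd_of_natCast_dvd_integralClosure {L : Type*} [Field L] [CharZero L] {a b : ℕ}
    (h : (a : integralClosure ℤ L) ∣ b) : a ∣ b := by
  obtain ⟨q, hq⟩ := h
  have hqL : (b : L) = a * q := by exact_mod_cast congrArg Subtype.val hq
  obtain rfl | ha := eq_or_ne a 0
  · rw [Nat.cast_zero, zero_mul] at hqL
    rw [Nat.cast_eq_zero.1 hqL]
  have hquot : algebraMap ℚ L (b / a) = q := by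
    rw [map_div₀, map_natCast, map_natCast, hqL, mul_div_cancel_left₀ _ (Nat.cast_ne_zero.2 ha)]
  have hint : IsIntegral ℤ (b / a : ℚ) := by
    rw [← isIntegral_algebraMap_iff (algebraMap ℚ L).injective, hquot]
    exact q.2
  obtain ⟨c, hc⟩ := IsIntegrallyClosed.isIntegral_iff.1 hint
  rw [eq_intCast, eq_div_iff (Nat.cast_ne_zero.2 ha)] at hc
  exact Int.natCast_dvd_natCast.1 (Dvd.intro_left c (by exact_mod_cast hc))

theorem isCoprime_pow_geom_sum {R : Type*} [CommRing R] (a : R) (k : ℕ) :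
    IsCoprime (a ^ k) (∑ j ∈ Finset.range (k + 1), a ^ j) := by
  rw [geom_sum_succ]
  exact IsCoprime.pow_left ⟨-∑ j ∈ Finset.range k, a ^ j, 1, by ring⟩

theorem geom_sum_add_le {R : Type*} [CommSemiring R] [PartialOrder R] [IsOrderedRing R] {r : R}
    (hr : 0 ≤ r) (i j : ℕ) : ∑ l ∈ Finset.range (i + j + 1), r ^ l ≤
      (∑ l ∈ Finset.range (i + 1), r ^ l) * ∑ l ∈ Finset.range (j + 1), r ^ l := by
  have hle : r ^ i ≤ ∑ l ∈ Finset.range (i + 1), r ^ l :=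
    Finset.single_le_sum (f := fun l => r ^ l) (fun l _ => pow_nonneg hr l) (by simp)
  calc ∑ l ∈ Finset.range (i + j + 1), r ^ l
      = ∑ l ∈ Finset.range (i + 1), r ^ l + r ^ i * ∑ l ∈ Finset.range j, r ^ (l + 1) := by
        rw [add_right_comm, Finset.sum_range_add, Finset.mul_sum]
        exact congrArg _ (Finset.sum_congr rfl fun l _ => by ring)
    _ ≤ ∑ l ∈ Finset.range (i + 1), r ^ l +
          (∑ l ∈ Finset.range (i + 1), r ^ l) * ∑ l ∈ Finset.range j, r ^ (l + 1) := by gcongr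
    _ = (∑ l ∈ Finset.range (i + 1), r ^ l) * ∑ l ∈ Finset.range (j + 1), r ^ l := by
        rw [Finset.sum_range_succ' _ j]
        ring

variable {d : ℤ} [UniqueFactorizationMonoid (quadRing d)]

theorem absNorm_pow_dvd_of_abundancy_eq (hd : d < 0) {n : ℕ} (hn : n ≠ 0) {p w : quadRing d}
    (hp : Prime p) (hw : w ≠ 0) {k : ℕ} (h : abundancy n w = abundancy n (p ^ k)) :
    absNorm p ^ k ∣ absNorm w := by
  let a : integralClosure ℤ ℝ := ⟨absVal p, isIntegral_absVal hd p⟩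
  let b : integralClosure ℤ ℝ := ⟨absVal w, isIntegral_absVal hd w⟩
  let D : integralClosure ℤ ℝ := ⟨delta n w, isIntegral_delta hd n w⟩
  have ha : a ^ 2 = absNorm p := Subtype.ext (by simp [a, cast_absNorm hd])
  have hb : b ^ 2 = absNorm w := Subtype.ext (by simp [b, cast_absNorm hd])
  have heq : (∑ j ∈ Finset.range (k + 1), (a ^ n) ^ j) * b ^ n = (a ^ n) ^ k * D := by
    have hpos := absVal_pos hp.ne_zero
    have hpos' := absVal_pos hw
    rw [abundancy, abundancy, delta_prime_pow hd _ hp, absVal_pow,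
      div_eq_div_iff (by positivity) (by positivity), zpow_natCast] at h
    ext
    push_cast
    rw [← pow_mul, mul_comm n k, pow_mul, mul_comm _ (delta n w)]
    exact h.symm
  have hdvd : (a ^ n) ^ k ∣ b ^ n := (isCoprime_pow_geom_sum (a ^ n) k).dvd_of_dvd_mul_left ⟨D, heq⟩
  refine (Nat.pow_dvd_pow_iff hn).1 (dvd_of_natCast_dvd_integralClosure (L := ℝ) ?_)
  push_cast
  rw [← ha, ← hb]
  convert pow_dvd_pow_of_dvd hdvd 2 using 1 <;> ring

theorem exists_pow_mul_conj_pow_dvd (hd : d < 0) {p w : quadRing d} (hp : Prime p) {k : ℕ}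
    (h : absNorm p ^ k ∣ absNorm w) :
    ∃ i j, i + j = k ∧ IsRelPrime (p ^ i) (conj p ^ j) ∧ p ^ i * conj p ^ j ∣ w := by
  have hdvd : p ^ k * conj p ^ k ∣ w * conj w := by
    rw [← mul_pow, mul_conj hd, mul_conj hd]
    exact_mod_cast Nat.cast_dvd_cast h
  have hsplit (l : ℕ) (hl : p ^ l ∣ w * conj w) :
      ∃ i j, i + j = l ∧ p ^ i ∣ w ∧ conj p ^ j ∣ w := by
    obtain ⟨a, ha⟩ := hl
    obtain ⟨i, j, b, c, hij, -, hi, hj⟩ := mul_eq_mul_prime_pow hp (ha.trans (mul_comm _ a))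
    refine ⟨i, j, hij, ⟨b, by rw [hi, mul_comm]⟩, ?_⟩
    simpa using map_dvd conj (Dvd.intro_left c hj.symm)
  by_cases hass : Associated p (conj p)
  · refine ⟨k, 0, add_zero k, by simpa using isRelPrime_one_right, ?_⟩
    obtain ⟨i, j, hij, hi, hj⟩ := hsplit (k + k) <| by
      rw [pow_add]
      exact (mul_dvd_mul_left _ hass.pow_pow.dvd).trans hdvd
    rw [pow_zero, mul_one]
    obtain hk | hk : k ≤ i ∨ k ≤ j := by omega
    · exact (pow_dvd_pow p hk).trans hi
    · exact hass.pow_pow.dvd.trans ((pow_dvd_pow _ hk).trans hj)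
  · obtain ⟨i, j, hij, hi, hj⟩ := hsplit k ((dvd_mul_right _ _).trans hdvd)
    have hrel : IsRelPrime (p ^ i) (conj p ^ j) :=
      (hp.irreducible.isRelPrime_iff_not_dvd.2 fun hdvd =>
        hass (hp.associated_of_dvd ((MulEquiv.prime_iff conj).2 hp) hdvd)).pow
    exact ⟨i, j, hij, hrel, hrel.mul_dvd hi hj⟩

theorem delta_pow_add_le_delta_pow_mul_conj_pow (hd : d < 0) (m : ℤ) {p : quadRing d}
    (hp : Prime p) {i j : ℕ} (h : IsRelPrime (p ^ i) (conj p ^ j)) :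
    delta m (p ^ (i + j)) ≤ delta m (p ^ i * conj p ^ j) := by
  have hcp : Prime (conj p) := (MulEquiv.prime_iff conj).2 hp
  rw [delta_mul hd m (pow_ne_zero i hp.ne_zero) (pow_ne_zero j hcp.ne_zero) h,
    delta_prime_pow hd m hp, delta_prime_pow hd m hp, delta_prime_pow hd m hcp, absVal_conj]
  exact geom_sum_add_le (zpow_nonneg (absVal_nonneg p) m) i j

theorem absVal_eq_of_abundancy_eq_prime_pow (hd : d < 0) {n : ℕ} (hn : n ≠ 0) {p w : quadRing d}
    (hp : Prime p) (hw : w ≠ 0) {k : ℕ} (h : abundancy n w = abundancy n (p ^ k)) :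
    absVal w = absVal p ^ k := by
  obtain ⟨i, j, rfl, hrel, hdvd⟩ :=
    exists_pow_mul_conj_pow_dvd hd hp (absNorm_pow_dvd_of_abundancy_eq hd hn hp hw h)
  have hx : p ^ i * conj p ^ j ≠ 0 := ne_zero_of_dvd_ne_zero hw hdvd
  have hle : abundancy n w ≤ abundancy n (p ^ i * conj p ^ j) := by
    rw [h, abundancy_eq_delta_neg hd n (pow_ne_zero _ hp.ne_zero), abundancy_eq_delta_neg hd n hx]
    exact delta_pow_add_le_delta_pow_mul_conj_pow hd _ hp hrel
  have hass : Associated (p ^ i * conj p ^ j) w :=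
    (abundancy_eq_iff_associated_of_dvd hd n hw hdvd).1
      (le_antisymm (abundancy_le_of_dvd hd n hw hdvd) hle)
  rw [← absVal_eq_of_associated hd hass, absVal_mul, absVal_pow, absVal_pow, absVal_conj, pow_add]

theorem powerfullySolitary_of_associated_prime_pow (hd : d < 0) {n : ℕ} (hn : n ≠ 0)
    {z p : quadRing d} {k : ℕ} (hp : Prime p) (h : Associated z (p ^ k)) :
    PowerfullySolitary n z := by
  have hpk : p ^ k ≠ 0 := pow_ne_zero k hp.ne_zero
  refine ⟨h.ne_zero_iff.2 hpk, ?_⟩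
  rintro ⟨w, -, hw, heq, hne⟩
  rw [(abundancy_eq_iff_associated_of_dvd hd n hpk h.dvd).2 h] at heq
  rw [absVal_eq_of_associated hd h, absVal_pow] at hne
  exact hne (absVal_eq_of_abundancy_eq_prime_pow hd hn hp hw heq.symm).symm

end Solitary

end QuadAbundancy

open QuadAbundancy in
theorem theorem2p2 (n : ℕ) (hn : 1 ≤ n) (d : ℤ) (hd : d ∈ K) :
    -- (a)
    (∀ z : quadRing d, z ≠ 0 →
      1 ≤ abundancy n z ∧ (abundancy n z = 1 ↔ IsUnit z) ∧
        (Even n → ∃ q : ℚ, abundancy n z = (q : ℝ))) ∧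
    -- (b)
    IsMultiplicative (abundancy n : quadRing d → ℝ) ∧
    -- (c)
    (∀ z : quadRing d, z ≠ 0 → abundancy n z = delta (-(n : ℤ)) z) ∧
    -- (d)
    (∀ z₁ z₂ : quadRing d, z₁ ≠ 0 → z₂ ≠ 0 → z₁ ∣ z₂ →
      abundancy n z₁ ≤ abundancy n z₂ ∧
        (abundancy n z₁ = abundancy n z₂ ↔ Associated z₁ z₂)) ∧
    -- (e)
    (∀ (z p : quadRing d) (k : ℕ), z ≠ 0 → Prime p → Associated z (p ^ k) →
      PowerfullySolitary n z) := by
  have hd0 := neg_of_mem_K hd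
  have := isPrincipalIdealRing hd
  refine ⟨fun z hz => ⟨?_, ?_, ?_⟩, ?_, fun z hz => ?_, fun z₁ z₂ _ hz₂ h => ⟨?_, ?_⟩,
    fun z p k _ hp h => ?_⟩
  · exact one_le_abundancy hd0 n hz
  · exact abundancy_eq_one_iff_isUnit hd0 n hz
  · exact fun hn => exists_rat_abundancy_eq hd0 hn z
  · exact isMultiplicative_abundancy hd0 n
  · exact abundancy_eq_delta_neg hd0 n hz
  · exact abundancy_le_of_dvd hd0 n hz₂ h
  · exact abundancy_eq_iff_associated_of_dvd hd0 n hz₂ h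
  · exact powerfullySolitary_of_associated_prime_pow hd0 (Nat.one_le_iff_ne_zero.1 hn) hp h
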